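/- Let $E$ be a finite ground set with $n=|E|$ elements and real weights $w:E\to\mathbb R$. A maximum-weight basis of a matroid on $E$ is a basis $B$ that maximizes $\sum_{e\in B}w_e$ among all bases. For two matroids $\mathcal M$ (clean) and $\mathcal M_d$ (dirty) on $E$, write $r$ and $r_d$ for their ranks. For $S\subseteq E$ let $a(S)$ be the smallest cardinality of a set $A\subseteq E\setminus S$ such that $S\cup A$ contains some maximum-weight basis of $\mathcal M$, and let $\rho(S)$ be the smallest cardinality of a set $R\subseteq S$ such that $S\setminus R$ is contained in some maximum-weight basis of $\mathcal M$. Define the errors $\eta_A=\max_S a(S)$ and $\eta_R=\max_S\rho(S)$, where $S$ ranges over all maximum-weight bases of $\mathcal M_d$. Theorem. For every integer $k\ge 1$ there is a deterministic algorithm with the following properties. Its input is $E$, $w$ and a maximum-weight basis $B_d$ of $\mathcal M_d$; it accesses $\mathcal M$ only by adaptive clean-oracle calls, each of which asks for one set $S\subseteq E$ whether $S$ is independent in $\mathcal M$; it knows neither $r$ nor $\eta_A$ nor $\eta_R$. For all finite $E$, all $w$, all matroids $\mathcal M_d$ and $\mathcal M$ on $E$ and every maximum-weight basis $B_d$ of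 $\mathcal M_d$, it outputs a maximum-weight basis of $\mathcal M$, its queries and their answers certify this (the output is a maximum-weight basis of every matroid on $E$ that gives the same answers to these queries), and it uses at most $$\min\Big\{\,n-r+k+\eta_A\,(k+1)+\eta_R\,(k+1)\lceil\log_2 r_d\rceil,\ \Big(1+\frac1k\Big)n\Big\}$$ clean-oracle calls (with $\lceil\log_2 0\rceil:=0$; if $r_d=0$ then $\eta_R=0$). In particular, it uses at most $n-r+k$ calls if $\mathcal M=\mathcal M_d$ (consistency), and at most $(1+\frac1k)n$ calls for every $\mathcal M_d$ and $\mathcal M$ (robustness). -/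

import Mathlib

universe u

/-- A deterministic adaptive algorithm with access to a clean independence oracle on subsets of
`E`, as a decision tree: either it stops with an output, or it asks the oracle about a set `S` and
continues according to the answer. Internal computation is free; only oracle calls are counted. -/
inductive OracleAlgorithm (E : Type u) (α : Type u) : Type u
  | output (a : α) : OracleAlgorithm E α
  | query (S : Finset E) (next : Bool → OracleAlgorithm E α) : OracleAlgorithm E α

namespace OracleAlgorithm

variable {E α : Type u}

/-- The output of an algorithm when the oracle answers according to `oracle`. -/
def result (oracle : Finset E → Bool) : OracleAlgorithm E α → α
  | output a => a
  | query S next => result oracle (next (oracle S))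

/-- The list of the sets queried during the run, one entry for every oracle call
(repeated queries are counted repeatedly). -/
def queries (oracle : Finset E → Bool) : OracleAlgorithm E α → List (Finset E)
  | output _ => []
  | query S next => S :: queries oracle (next (oracle S))

/-- The number of oracle calls made during the run. -/
def calls (oracle : Finset E → Bool) (T : OracleAlgorithm E α) : ℕ :=
  (T.queries oracle).length

end OracleAlgorithm

/-- An algorithm for the maximum-weight basis problem: from a finite ground set, weights, and a
predicted solution (a subset of the ground set), it determines a strategy that queries the
clean independence oracle and outputs a set. It receives no further information; in particular it
is given neither the errors of the prediction nor the rank of the clean matroid. -/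
def MaxWeightBasisAlgorithm : Type (u + 1) :=
  ∀ (E : Type u) [Fintype E], (E → ℝ) → Finset E → OracleAlgorithm E (Finset E)

open Classical in
/-- The independence oracle of a matroid. -/
noncomputable def indepOracle {E : Type u} (M : Matroid E) (S : Finset E) : Bool :=
  decide (M.Indep (S : Set E))

/-- `B` is a maximum-weight basis of `M`. -/
def IsMaxWeightBase {E : Type u} (M : Matroid E) (w : E → ℝ) (B : Finset E) : Prop :=
  M.IsBase (B : Set E) ∧
    ∀ B' : Finset E, M.IsBase (B' : Set E) → ∑ e ∈ B', w e ≤ ∑ e ∈ B, w e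

/-- The smallest cardinality of a set `A` of elements outside `S` such that `S ∪ A` contains a
maximum-weight basis of `M`. -/
noncomputable def additionDistance {E : Type u} (M : Matroid E) (w : E → ℝ) (S : Finset E) : ℕ :=
  sInf {m : ℕ | ∃ A : Finset E, Disjoint A S ∧
    (∃ B : Finset E, IsMaxWeightBase M w B ∧ (B : Set E) ⊆ (S : Set E) ∪ (A : Set E)) ∧
    A.card = m}

/-- The smallest cardinality of a set `R ⊆ S` such that `S \ R` is contained in a
maximum-weight basis of `M`. -/
noncomputable def removalDistance {E : Type u} (M : Matroid E) (w : E → ℝ) (S : Finset E) : ℕ :=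
  sInf {m : ℕ | ∃ R : Finset E, R ⊆ S ∧
    (∃ B : Finset E, IsMaxWeightBase M w B ∧ (S : Set E) \ (R : Set E) ⊆ (B : Set E)) ∧
    R.card = m}

/-- The addition error `η_A` of the dirty matroid `Md` with respect to the clean matroid `M`: the
maximum of the addition distance over all maximum-weight bases of `Md`. -/
noncomputable def additionError {E : Type u} (M Md : Matroid E) (w : E → ℝ) : ℕ :=
  sSup (additionDistance M w '' {S : Finset E | IsMaxWeightBase Md w S})

/-- The removal error `η_R` of the dirty matroid `Md` with respect to the clean matroid `M`: the
maximum of the removal distance over all maximum-weight bases of `Md`. -/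
noncomputable def removalError {E : Type u} (M Md : Matroid E) (w : E → ℝ) : ℕ :=
  sSup (removalDistance M w '' {S : Finset E | IsMaxWeightBase Md w S})

/-- The rank of a matroid (of finite rank) as a natural number. -/
noncomputable def matroidRank {E : Type u} (M : Matroid E) : ℕ :=
  M.eRank.toNat

/-- The queries that `T` makes on the clean matroid `M`, together with their answers, certify its
output: the output is a maximum-weight basis of every matroid on `E` (so also of `M`) whose
oracle gives the same answers to these queries. -/
def CertifiesMaxWeightBase {E : Type u} (T : OracleAlgorithm E (Finset E)) (M : Matroid E)
    (w : E → ℝ) : Prop :=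
  ∀ M' : Matroid E, M'.E = Set.univ →
    (∀ S ∈ T.queries (indepOracle M), indepOracle M' S = indepOracle M S) →
    IsMaxWeightBase M' w (T.result (indepOracle M))

/-! List the elements by non-increasing weight, those of P = B_d first among equals. Greedy on this
list yields a maximum-weight basis G whose overlap with P is largest among all of them
(`greedy_isBase_and_setLexLE`). All bases have the same size, so G minimises |G \ P| and |P \ G|
simultaneously, and these are at most η_A and η_R.

The algorithm computes this same G with fewer queries (`testAndRepair_spec`). If the current set I
together with all remaining predicted elements is independent, predicted elements are free until an
unpredicted one enters. Otherwise binary search finds the first predicted element closing a circuit;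
greedy would discard it too (`greedy_append_cons_of_dep`).

Both bounds are amortised. For robustness, an element brings k + 1 units and a query costs k, so a
plain greedy step saves one unit; the steps between tests pay for tests and searches. For the error
bound, `charge` distributes the queries over the elements and sums to n - r plus the error terms
(`sum_charge`); the first phase contributes the extra k.

The certificate comes for free: the algorithm is correct on every matroid and cannot tell apart two
that answer its queries alike. -/

namespace OracleAlgorithm

variable {E α β : Type u}

/-- Sequential composition of oracle algorithms. -/
def bind (T : OracleAlgorithm E α) (g : α → OracleAlgorithm E β) : OracleAlgorithm E β :=
  match T with
  | output a => g a
  | query S next => query S fun b => bind (next b) g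

theorem result_bind (o : Finset E → Bool) (T : OracleAlgorithm E α)
    (g : α → OracleAlgorithm E β) : (T.bind g).result o = (g (T.result o)).result o := by
  induction T with
  | output a => rfl
  | query S next ih => exact ih _

@[simp] theorem calls_output (o : Finset E → Bool) (a : α) :
    (output a : OracleAlgorithm E α).calls o = 0 := rfl

@[simp] theorem calls_query (o : Finset E → Bool) (S : Finset E)
    (next : Bool → OracleAlgorithm E α) :
    (query S next).calls o = (next (o S)).calls o + 1 := rfl

theorem calls_bind (o : Finset E → Bool) (T : OracleAlgorithm E α)
    (g : α → OracleAlgorithm E β) :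
    (T.bind g).calls o = T.calls o + (g (T.result o)).calls o := by
  induction T with
  | output a => simp [bind, result]
  | query S next ih => simp only [bind, result, calls_query, ih]; omega

/-- An algorithm cannot distinguish two oracles that agree on its queries. -/
theorem result_eq_of_agree (o o' : Finset E → Bool) (T : OracleAlgorithm E α)
    (h : ∀ S ∈ T.queries o, o' S = o S) : T.result o' = T.result o := by
  induction T with
  | output a => rfl
  | query S next ih =>
    simp only [queries, List.mem_cons, forall_eq_or_imp] at h
    simp only [result, h.1]
    exact ih _ h.2

end OracleAlgorithm

theorem indepOracle_eq_true {E : Type u} {M : Matroid E} {S : Finset E} :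
    indepOracle M S = true ↔ M.Indep (S : Set E) := by
  simp [indepOracle]

theorem indepOracle_eq_false {E : Type u} {M : Matroid E} {S : Finset E} :
    indepOracle M S = false ↔ ¬ M.Indep (S : Set E) := by
  simp [indepOracle]

/-! ### Greedy on an ordered list: span, exchange and lexicographic optimality. -/

section Greedy

variable {E : Type u} [DecidableEq E]

/-- The greedy algorithm that runs through a list and keeps an element whenever the oracle
accepts the enlarged set. -/
def greedy (o : Finset E → Bool) (I : Finset E) : List E → Finset E
  | [] => I
  | e :: l => if o (insert e I) then greedy o (insert e I) l else greedy o I l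

theorem subset_greedy (o : Finset E → Bool) (I : Finset E) (l : List E) :
    I ⊆ greedy o I l := by
  induction l generalizing I with
  | nil => exact subset_rfl
  | cons e l ih =>
    simp only [greedy]
    split
    · exact (Finset.subset_insert _ _).trans (ih _)
    · exact ih _

theorem greedy_subset (o : Finset E → Bool) (I : Finset E) (l : List E) :
    greedy o I l ⊆ I ∪ l.toFinset := by
  induction l generalizing I with
  | nil => simp [greedy]
  | cons e l ih =>
    simp only [greedy]
    split
    · exact (ih _).trans (by intro x; simp)
    · exact (ih _).trans (by intro x; simp; tauto)

theorem greedy_append (o : Finset E → Bool) (I : Finset E) (l l' : List E) :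
    greedy o I (l ++ l') = greedy o (greedy o I l) l' := by
  induction l generalizing I with
  | nil => rfl
  | cons e l ih =>
    simp only [greedy, List.cons_append]
    split <;> exact ih _

theorem greedy_indep {M : Matroid E} {I : Finset E} (hI : M.Indep (I : Set E)) (l : List E) :
    M.Indep (greedy (indepOracle M) I l : Set E) := by
  induction l generalizing I with
  | nil => exact hI
  | cons e l ih =>
    simp only [greedy]
    split
    · next h => exact ih (indepOracle_eq_true.1 h)
    · exact ih hI

theorem notMem_greedy {M : Matroid E} {I : Finset E} (hI : M.Indep (I : Set E)) (l : List E)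
    {e : E} (he : ¬ M.Indep (insert e I : Finset E)) : e ∉ greedy (indepOracle M) I l := by
  intro h
  exact he ((greedy_indep hI l).subset
    (by exact_mod_cast Finset.insert_subset h (subset_greedy _ _ _)))

/-- The kept set only grows, so an element rejected once stays dependent on the final set. -/
theorem subset_closure_greedy {M : Matroid E} (hE : M.E = Set.univ) {I : Finset E}
    (hI : M.Indep (I : Set E)) (l : List E) :
    ((I ∪ l.toFinset : Finset E) : Set E) ⊆ M.closure (greedy (indepOracle M) I l : Set E) := by
  intro x hx
  rw [(greedy_indep hI l).mem_closure_iff']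
  refine ⟨by simp [hE], fun hxi => ?_⟩
  induction l generalizing I with
  | nil => simpa [greedy] using hx
  | cons e l ih =>
    simp only [greedy] at hxi ⊢
    simp only [List.toFinset_cons, Finset.coe_union, Finset.coe_insert, Set.mem_union,
      Set.mem_insert_iff, Finset.mem_coe] at hx
    split at hxi
    · next h =>
      rw [if_pos h]
      exact ih (indepOracle_eq_true.1 h) (by simp; simp at hx; tauto) hxi
    · next h =>
      rw [if_neg h]
      rw [Bool.not_eq_true, indepOracle_eq_false] at h
      refine ih hI ?_ hxi
      rcases hx with hx | rfl | hx
      · simp [hx]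
      · refine absurd (hxi.subset ?_) h
        rw [Finset.coe_insert]
        exact Set.insert_subset_insert (by exact_mod_cast subset_greedy _ _ _)
      · simp at hx; simp [hx]

/-- An element spanned by the kept set and earlier elements is discarded by the greedy
algorithm, so it may be dropped from the list. -/
theorem greedy_append_cons_of_dep {M : Matroid E} (hE : M.E = Set.univ) {I J : Finset E}
    (hI : M.Indep (I : Set E)) {a b : List E} {f : E} (hJ : M.Indep (J : Set E))
    (hJa : J ⊆ I ∪ a.toFinset) (hIJ : I ⊆ J) (hfa : f ∉ a)
    (hf : ¬ M.Indep (insert f J : Finset E)) :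
    greedy (indepOracle M) I (a ++ f :: b) = greedy (indepOracle M) I (a ++ b) ∧
      f ∉ greedy (indepOracle M) I (a ++ b) := by
  have hfJ : f ∉ J := fun h => hf (by rwa [Finset.insert_eq_of_mem h])
  have hfc : f ∈ M.closure (J : Set E) := by
    rw [hJ.mem_closure_iff']
    refine ⟨by simp [hE], fun h => absurd (by simpa using h) hf⟩
  have hcl : M.closure (J : Set E) ⊆ M.closure (greedy (indepOracle M) I a : Set E) :=
    M.closure_subset_closure_of_subset_closure
      (Set.Subset.trans (by exact_mod_cast hJa) (subset_closure_greedy hE hI a))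
  have hfg : f ∉ greedy (indepOracle M) I a := by
    intro h
    have := greedy_subset _ _ _ h
    simp only [Finset.mem_union, List.mem_toFinset] at this
    exact this.elim (fun h => hfJ (hIJ h)) hfa
  have hdep : ¬ M.Indep (insert f (greedy (indepOracle M) I a) : Finset E) := by
    intro h
    have := ((greedy_indep hI a).mem_closure_iff'.1 (hcl hfc)).2 (by simpa using h)
    exact hfg (by simpa using this)
  rw [greedy_append, greedy_append]
  refine ⟨?_, notMem_greedy (greedy_indep hI a) b hdep⟩
  rw [greedy, if_neg (by simpa [indepOracle_eq_false] using hdep)]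

/-- Extend I + e to a basis B' inside B + e. Then B' \ B = {e}, so B \ B' is also a single element
f, and f is not in I because I ⊆ B'. -/
theorem exists_exchange {M : Matroid E} {I B : Finset E} {e : E}
    (hB : M.IsBase (B : Set E)) (hIB : I ⊆ B) (heB : e ∉ B)
    (he : M.Indep (insert e I : Finset E)) :
    ∃ f ∈ B, f ∉ I ∧ M.IsBase (insert e (B.erase f) : Finset E) := by
  obtain ⟨B', hB', hIB', hsub⟩ := he.exists_isBase_subset_union_isBase hB
  have heB' : e ∈ B' := hIB' (by simp)
  have h1 : B' \ B = {e} := by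
    ext x
    constructor
    · rintro ⟨hx, hxB⟩
      rcases hsub hx with h | h
      · simp only [Finset.coe_insert, Set.mem_insert_iff, Finset.mem_coe] at h
        rcases h with h | h
        · exact h
        · exact absurd (hIB h) hxB
      · exact absurd h hxB
    · rintro rfl
      exact ⟨heB', by simpa using heB⟩
  have h2 : ((B : Set E) \ B').encard = 1 := by
    rw [← hB'.encard_sdiff_comm hB, h1, Set.encard_singleton]
  obtain ⟨f, hf⟩ := Set.encard_eq_one.1 h2
  have hfm : f ∈ (B : Set E) \ B' := by rw [hf]; rfl
  refine ⟨f, hfm.1, fun h => hfm.2 (hIB' (by simp [h])), ?_⟩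
  convert hB' using 1
  ext x
  have hx1 : x ∈ B' \ (B : Set E) ↔ x = e := by rw [h1]; rfl
  have hx2 : x ∈ (B : Set E) \ B' ↔ x = f := by rw [hf]; rfl
  simp only [Set.mem_sdiff, Finset.mem_coe] at hx1 hx2
  simp only [Finset.coe_insert, Finset.coe_erase, Set.mem_insert_iff, Set.mem_sdiff,
    Finset.mem_coe, Set.mem_singleton_iff]
  tauto

/-- `f` does not precede `e` strictly when elements are ordered by non-increasing weight, with
ties broken in favour of `P`. -/
def LexLE (w : E → ℝ) (P : Finset E) (f e : E) : Prop :=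
  w f < w e ∨ (w f = w e ∧ (f ∈ P → e ∈ P))

/-- Lexicographic comparison of two sets by total weight and by the overlap with `P`. -/
def SetLexLE (w : E → ℝ) (P : Finset E) (B G : Finset E) : Prop :=
  ∑ x ∈ B, w x < ∑ x ∈ G, w x ∨
    (∑ x ∈ B, w x = ∑ x ∈ G, w x ∧ (B ∩ P).card ≤ (G ∩ P).card)

theorem SetLexLE.trans {w : E → ℝ} {P A B C : Finset E} (h₁ : SetLexLE w P A B)
    (h₂ : SetLexLE w P B C) : SetLexLE w P A C := by
  rcases h₁ with h₁ | ⟨h₁, h₁'⟩ <;> rcases h₂ with h₂ | ⟨h₂, h₂'⟩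
  · exact Or.inl (h₁.trans h₂)
  · exact Or.inl (h₂ ▸ h₁)
  · exact Or.inl (h₁ ▸ h₂)
  · exact Or.inr ⟨h₁.trans h₂, h₁'.trans h₂'⟩

theorem setLexLE_exchange {w : E → ℝ} {P B : Finset E} {e f : E} (hf : f ∈ B) (he : e ∉ B)
    (h : LexLE w P f e) : SetLexLE w P B (insert e (B.erase f)) := by
  have he' : e ∉ B.erase f := fun h => he (Finset.mem_of_mem_erase h)
  have hs := Finset.add_sum_erase B w hf
  rw [SetLexLE, Finset.sum_insert he']
  rcases h with h | ⟨h, h'⟩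
  · left; linarith
  · refine Or.inr ⟨by linarith, ?_⟩
    rw [Finset.card_eq_sum_ones, Finset.card_eq_sum_ones, ← Finset.filter_mem_eq_inter,
      ← Finset.filter_mem_eq_inter, Finset.sum_filter, Finset.sum_filter, Finset.sum_insert he',
      ← Finset.add_sum_erase B _ hf]
    gcongr
    split_ifs <;> simp_all

/-- The competitor B always lies between I and I plus the rest of the list. If greedy accepts e
outside B, e is exchanged for a later element of B, which cannot worsen B in the order; at the end B
has become the greedy set. -/
theorem greedy_isBase_and_setLexLE {M : Matroid E} {w : E → ℝ} {P I B : Finset E} {l : List E}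
    (hl : l.Pairwise fun e f => LexLE w P f e) (hI : M.Indep (I : Set E))
    (hB : M.IsBase (B : Set E)) (hIB : I ⊆ B) (hBl : B ⊆ I ∪ l.toFinset) :
    M.IsBase (greedy (indepOracle M) I l : Set E) ∧
      SetLexLE w P B (greedy (indepOracle M) I l) := by
  induction l generalizing I B with
  | nil =>
    obtain rfl : I = B := hIB.antisymm (by simpa using hBl)
    exact ⟨hB, Or.inr ⟨rfl, le_rfl⟩⟩
  | cons e l ih =>
    rw [List.pairwise_cons] at hl
    simp only [greedy]
    split
    · next h =>
      rw [indepOracle_eq_true] at h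
      by_cases heB : e ∈ B
      · exact ih hl.2 h hB (Finset.insert_subset heB hIB)
          (hBl.trans (by intro x; simp))
      · obtain ⟨f, hfB, hfI, hB'⟩ := exists_exchange hB hIB heB h
        have hfl : f ∈ l := by
          have := hBl hfB
          simp only [List.toFinset_cons, Finset.mem_union, Finset.mem_insert,
            List.mem_toFinset] at this
          rcases this with h | rfl | h
          · exact absurd h hfI
          · exact absurd hfB heB
          · exact h
        obtain ⟨h1, h2⟩ := ih hl.2 h hB'
          (Finset.insert_subset_insert _ fun x hx =>
            Finset.mem_erase.2 ⟨fun h => hfI (h ▸ hx), hIB hx⟩)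
          (by
            intro x hx
            simp only [Finset.mem_insert, Finset.mem_erase] at hx
            rcases hx with rfl | ⟨-, hx⟩
            · simp
            · have := hBl hx
              simp at this ⊢
              tauto)
        exact ⟨h1, (setLexLE_exchange hfB heB (hl.1 f hfl)).trans h2⟩
    · next h =>
      rw [Bool.not_eq_true, indepOracle_eq_false] at h
      have heB : e ∉ B := fun heB =>
        h (hB.indep.subset (by exact_mod_cast Finset.insert_subset heB hIB))
      refine ih hl.2 hI hB hIB fun x hx => ?_
      have := hBl hx
      simp only [List.toFinset_cons, Finset.mem_union, Finset.mem_insert,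
            List.mem_toFinset] at this ⊢
      rcases this with h | rfl | h
      · exact Or.inl h
      · exact absurd hx heB
      · exact Or.inr h

theorem exists_ordered_list [Fintype E] (w : E → ℝ) (P : Finset E) :
    ∃ l : List E, l.Nodup ∧ (∀ e, e ∈ l) ∧ l.Pairwise fun e f => LexLE w P f e := by
  classical
  let r : E → E → Prop := fun e f => LexLE w P f e
  have : IsTrans E r := ⟨by
    rintro a b c (h | ⟨h, h'⟩) (g | ⟨g, g'⟩)
    · exact Or.inl (g.trans h)
    · exact Or.inl (g ▸ h)
    · exact Or.inl (h ▸ g)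
    · exact Or.inr ⟨g.trans h, h' ∘ g'⟩⟩
  have : Std.Total r := ⟨by
    intro a b
    rcases lt_trichotomy (w a) (w b) with h | h | h
    · exact Or.inr (Or.inl h)
    · by_cases ha : a ∈ P
      · exact Or.inl (Or.inr ⟨h.symm, fun _ => ha⟩)
      · exact Or.inr (Or.inr ⟨h, fun h => absurd h ha⟩)
    · exact Or.inl (Or.inl h)⟩
  have hp := List.mergeSort_perm (Finset.univ : Finset E).toList (r · ·)
  exact ⟨_, hp.nodup_iff.2 (Finset.nodup_toList _), fun e => hp.mem_iff.2 (by simp),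
    List.pairwise_mergeSort' r _⟩

end Greedy

/-- Transfers the position found by the search among the predicted elements to the full list. -/
theorem filter_eq_append_cons {α : Type*} {p : α → Prop} [DecidablePred p] {l a b : List α}
    {f : α}
    (h : l.filter (p ·) = a ++ f :: b) (hfa : f ∉ a) :
    ∃ a' b', l = a' ++ f :: b' ∧ a'.filter (p ·) = a ∧ f ∉ a' := by
  obtain ⟨l₁, l₂, rfl, h₁, h₂⟩ := List.filter_eq_append_iff.1 h
  obtain ⟨l₃, l₄, rfl, h₃, h₄, -⟩ := List.filter_eq_cons_iff.1 h₂
  have hf : (l₁ ++ l₃).filter (p ·) = a := by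
    rw [List.filter_append, h₁, List.filter_eq_nil_iff.2 h₃, List.append_nil]
  refine ⟨l₁ ++ l₃, l₄, by simp, hf, fun hmem => hfa ?_⟩
  rw [← hf]
  exact List.mem_filter.2 ⟨hmem, h₄⟩

/-! ### The algorithm and its amortised query count. -/

section Algorithm

variable {E : Type u} [DecidableEq E]

/-- Binary search: given an independent set `I` and a list `c` of at most `2 ^ n` elements such
that `I ∪ c` is dependent, find the first element of `c` that closes a circuit, with `n` queries.
The element `x` is a default value. -/
def search (x : E) : ℕ → Finset E → List E → OracleAlgorithm E E
  | 0, _, c => .output (c.headD x)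
  | n + 1, I, c => .query (I ∪ (c.take (c.length / 2)).toFinset) fun b =>
      if b then search x n (I ∪ (c.take (c.length / 2)).toFinset) (c.drop (c.length / 2))
      else search x n I (c.take (c.length / 2))

theorem calls_search (o : Finset E → Bool) (x : E) (n : ℕ) (I : Finset E) (c : List E) :
    (search x n I c).calls o = n := by
  induction n generalizing I c with
  | zero => rfl
  | succ n ih =>
    simp only [search, OracleAlgorithm.calls_query]
    split <;> rw [ih]

theorem search_spec {M : Matroid E} (x : E) {n : ℕ} {I : Finset E} {c : List E}
    (hI : M.Indep (I : Set E)) (hc : ¬ M.Indep (I ∪ c.toFinset : Finset E))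
    (hn : c.length ≤ 2 ^ n) :
    ∃ a b, c = a ++ (search x n I c).result (indepOracle M) :: b ∧
      M.Indep (I ∪ a.toFinset : Finset E) ∧
      ¬ M.Indep (insert ((search x n I c).result (indepOracle M)) (I ∪ a.toFinset) :
        Finset E) := by
  induction n generalizing I c with
  | zero =>
    match c with
    | [] => simp [hI] at hc
    | [y] =>
      refine ⟨[], [], by simp [search, OracleAlgorithm.result], by simpa using hI, ?_⟩
      have : I ∪ [y].toFinset = insert y (I ∪ ([] : List E).toFinset) := by
        ext; simp
      rw [this] at hc
      simpa [search, OracleAlgorithm.result] using hc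
    | y :: z :: t => simp at hn
  | succ n ih =>
    simp only [search, OracleAlgorithm.result]
    have hcat := List.take_append_drop (c.length / 2) c
    rw [pow_succ] at hn
    split
    · next h =>
      rw [indepOracle_eq_true] at h
      obtain ⟨a, b, h1, h2, h3⟩ := ih (c := c.drop (c.length / 2)) h
        (by
          rw [Finset.union_assoc, ← List.toFinset_append, hcat]
          exact hc)
        (by rw [List.length_drop]; omega)
      refine ⟨c.take (c.length / 2) ++ a, b, ?_, ?_, ?_⟩
      · conv_lhs => rw [← hcat, h1]
        rw [List.append_assoc]
      · rwa [List.toFinset_append, ← Finset.union_assoc]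
      · rwa [List.toFinset_append, ← Finset.union_assoc]
    · next h =>
      rw [Bool.not_eq_true, indepOracle_eq_false] at h
      obtain ⟨a, b, h1, h2, h3⟩ := ih (c := c.take (c.length / 2)) hI h
        (by rw [List.length_take]; omega)
      refine ⟨a, b ++ c.drop (c.length / 2), ?_, h2, h3⟩
      conv_lhs => rw [← hcat, h1]
      simp

/-- Run the greedy algorithm on the rest of the list, querying every element. -/
def finish (I : Finset E) : List E → OracleAlgorithm E (Finset E)
  | [] => .output I
  | e :: l => .query (insert e I) fun b => if b then finish (insert e I) l else finish I l

theorem result_finish (o : Finset E → Bool) (I : Finset E) (l : List E) :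
    (finish I l).result o = greedy o I l := by
  induction l generalizing I with
  | nil => rfl
  | cons e l ih =>
    simp only [finish, greedy, OracleAlgorithm.result]
    split <;> exact ih _

theorem calls_finish (o : Finset E → Bool) (I : Finset E) (l : List E) :
    (finish I l).calls o = l.length := by
  induction l generalizing I with
  | nil => rfl
  | cons e l ih =>
    simp only [finish, OracleAlgorithm.calls_query, List.length_cons]
    split <;> rw [ih]

/-- Accept the predicted elements (those in `P`) without a query and query the others, until one
of these is accepted; then continue with `K`. -/
def trust (P : Finset E) (K : Finset E → List E → OracleAlgorithm E (Finset E)) (I : Finset E) :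
    List E → OracleAlgorithm E (Finset E)
  | [] => .output I
  | e :: l =>
    if e ∈ P then trust P K (insert e I) l
    else .query (insert e I) fun b => if b then K (insert e I) l else trust P K I l

/-- Run `d` greedy steps, then test whether all remaining predicted elements can be accepted.
If so, trust them until the next addition. Otherwise search the first one that has to be
discarded, unless so few are left that querying them one by one is as cheap. The first argument
is at least the length of the list. -/
def testAndRepair (k : ℕ) (P : Finset E) :
    ℕ → ℕ → Finset E → List E → OracleAlgorithm E (Finset E)
  | 0, _, I, _ => .output I
  | _ + 1, _, I, [] => .output I
  | n + 1, d, I, e :: l =>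
    if d ≠ 0 ∨ (e :: l).filter (· ∈ P) = [] then
      .query (insert e I) fun b =>
        if b then testAndRepair k P n (d - 1) (insert e I) l
        else testAndRepair k P n (d - 1) I l
    else
      .query (I ∪ ((e :: l).filter (· ∈ P)).toFinset) fun b =>
        if b then trust P (testAndRepair k P n (k - 1)) I (e :: l)
        else
          if ((e :: l).filter (· ∈ P)).length <
              k * Nat.clog 2 ((e :: l).filter (· ∈ P)).length then
            finish I (e :: l)
          else
            (search e (Nat.clog 2 ((e :: l).filter (· ∈ P)).length) I
              ((e :: l).filter (· ∈ P))).bind fun f =>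
              testAndRepair k P n (k * Nat.clog 2 ((e :: l).filter (· ∈ P)).length - 1) I
                ((e :: l).erase f)

/-- The number of queries charged to an element, given the final basis `G`. -/
def charge (k L : ℕ) (P G : Finset E) (e : E) : ℕ :=
  if e ∈ G then (if e ∈ P then 0 else k + 1) else (if e ∈ P then 1 + (k + 1) * L else 1)

/-- The number of queries charged to no element: `d` greedy steps and a successful test, if there
is anything left to test. -/
def slack (P : Finset E) (d : ℕ) (l : List E) : ℕ :=
  if l.filter (· ∈ P) = [] then 0 else d + 1

/-- The guarantees for a run `T` from the state `(I, l)`, where `c` bounds the credit below and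
`s` is the number of uncharged queries. -/
structure RunSpec (M : Matroid E) (k L : ℕ) (P : Finset E) (I : Finset E) (l : List E) (c : ℤ)
    (s : ℕ) (T : OracleAlgorithm E (Finset E)) : Prop where
  result_eq : T.result (indepOracle M) = greedy (indepOracle M) I l
  calls_le : ∀ x : ℤ, c ≤ x → 0 ≤ x + l.length →
    (k : ℤ) * T.calls (indepOracle M) ≤ (k + 1) * l.length + x
  calls_le_charge : T.calls (indepOracle M) ≤
    (l.map (charge k L P (greedy (indepOracle M) I l))).sum + s

/-- Independence of I with all remaining predicted elements persists until an unpredicted element is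
accepted, so greedy would accept every predicted one. The bound -1 is the debt of one unit left by
the test. The charge k + 1 of an accepted unpredicted element pays its query and the slack k of the
phase that follows. -/
theorem trust_spec {M : Matroid E} {k L n : ℕ} (hk : 1 ≤ k) {P : Finset E}
    {K : Finset E → List E → OracleAlgorithm E (Finset E)}
    (hK : ∀ (I : Finset E) (l : List E), M.Indep (I : Set E) → l.length ≤ n →
      Nat.clog 2 (l.filter (· ∈ P)).length ≤ L → RunSpec M k L P I l 0 k (K I l))
    {I : Finset E} {l : List E} (hI : M.Indep (I ∪ (l.filter (· ∈ P)).toFinset : Finset E))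
    (hn : l.length ≤ n + 1) (hL : Nat.clog 2 (l.filter (· ∈ P)).length ≤ L) :
    RunSpec M k L P I l (-1) 0 (trust P K I l) := by
  induction l generalizing I with
  | nil => exact ⟨rfl, by intro x _ h; simpa [trust] using h, by simp [trust]⟩
  | cons e l ih =>
    have hIi : M.Indep (I : Set E) := hI.subset (by simp)
    by_cases heP : e ∈ P
    · have hset : I ∪ ((e :: l).filter (· ∈ P)).toFinset =
          insert e I ∪ (l.filter (· ∈ P)).toFinset := by
        ext y; simp [heP]
      rw [hset] at hI
      have hins : M.Indep (insert e I : Finset E) := hI.subset (by exact_mod_cast Finset.subset_union_left)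
      obtain ⟨h1, h2, h3⟩ := ih hI (by simp at hn; omega)
        (le_trans (Nat.clog_mono_right _ (by simp [heP])) hL)
      have hg : greedy (indepOracle M) I (e :: l) = greedy (indepOracle M) (insert e I) l := by
        rw [greedy, if_pos (indepOracle_eq_true.2 hins)]
      have heG : e ∈ greedy (indepOracle M) (insert e I) l :=
        subset_greedy _ _ _ (Finset.mem_insert_self _ _)
      rw [trust, if_pos heP]
      refine ⟨by rw [h1, hg], fun x hx hx' => ?_, ?_⟩
      · have := h2 (x + 1) (by omega) (by omega)
        push_cast [List.length_cons] at this ⊢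
        nlinarith
      · rw [hg, List.map_cons, List.sum_cons]
        omega
    · have hset : ((e :: l).filter (· ∈ P)) = l.filter (· ∈ P) := by simp [heP]
      rw [hset] at hI hL
      rw [trust, if_neg heP]
      by_cases hins : M.Indep (insert e I : Finset E)
      · have hg : greedy (indepOracle M) I (e :: l) =
            greedy (indepOracle M) (insert e I) l := by
          rw [greedy, if_pos (indepOracle_eq_true.2 hins)]
        have heG : e ∈ greedy (indepOracle M) (insert e I) l :=
          subset_greedy _ _ _ (Finset.mem_insert_self _ _)
        obtain ⟨h1, h2, h3⟩ := hK (insert e I) l hins (by simp at hn; omega) hL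
        rw [← indepOracle_eq_true] at hins
        refine ⟨by simp [OracleAlgorithm.result, hins, h1, hg], fun x hx hx' => ?_, ?_⟩
        · have := h2 (x + 1) (by omega) (by push_cast [List.length_cons] at hx'; omega)
          simp only [OracleAlgorithm.calls_query, hins, if_true]
          push_cast [List.length_cons] at this ⊢
          nlinarith
        · simp only [OracleAlgorithm.calls_query, hins, if_true]
          rw [hg, List.map_cons, List.sum_cons]
          have : charge k L P (greedy (indepOracle M) (insert e I) l) e = k + 1 := by
            simp [charge, heG, heP]
          omega
      · have heG := notMem_greedy hIi l hins
        rw [← indepOracle_eq_false] at hins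
        have hg : greedy (indepOracle M) I (e :: l) = greedy (indepOracle M) I l := by
          rw [greedy, if_neg (by simp [hins])]
        obtain ⟨h1, h2, h3⟩ := ih hI (by simp at hn; omega) hL
        refine ⟨by simp [OracleAlgorithm.result, hins, h1, hg], fun x hx hx' => ?_, ?_⟩
        · have := h2 (x + 1) (by omega) (by push_cast [List.length_cons] at hx'; omega)
          simp only [OracleAlgorithm.calls_query, hins, Bool.false_eq_true, if_false]
          push_cast [List.length_cons] at this ⊢
          nlinarith
        · simp only [OracleAlgorithm.calls_query, hins, Bool.false_eq_true, if_false]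
          rw [hg, List.map_cons, List.sum_cons]
          have : charge k L P (greedy (indepOracle M) I l) e = 1 := by
            simp [charge, heG, heP]
          omega

/-- If some predicted element of the list is discarded, the charges pay for querying every
element and for one test. -/
theorem length_lt_sum_charge {k L : ℕ} {P G : Finset E} {l : List E}
    (hG : ∃ e ∈ l, e ∈ P ∧ e ∉ G) (hq : (l.filter (· ∈ P)).length < k * L) :
    l.length + 1 ≤ (l.map (charge k L P G)).sum := by
  have key : ∀ l : List E,
      l.length ≤ (l.map (charge k L P G)).sum + (l.filter (· ∈ P)).length := by
    intro l
    induction l with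
    | nil => simp
    | cons e l ih =>
      by_cases heP : e ∈ P
      · simp [heP]; omega
      · have : 1 ≤ charge k L P G e := by
          simp only [charge, heP, if_false]; split <;> omega
        simp [heP]; omega
  -- One discarded predicted element carries 1 + (k + 1) * L, more than the fewer than k * L
  -- predicted elements and the test need.
  obtain ⟨e, hel, heP, heG⟩ := hG
  have h1 := key (l.erase e)
  have h2 := (List.perm_cons_erase hel).map (charge k L P G) |>.sum_eq
  have h3 := ((List.perm_cons_erase hel).filter (· ∈ P)).length_eq
  have h4 := (List.perm_cons_erase hel).length_eq
  have h5 : charge k L P G e = 1 + (k + 1) * L := by simp [charge, heP, heG]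
  simp only [List.map_cons, List.sum_cons, List.length_cons] at h2 h4
  rw [List.filter_cons_of_pos (by simpa using heP), List.length_cons] at h3
  rw [add_mul] at h5
  omega

/-- The required credit k - 1 - d rises by one with each greedy step, as the saved unit does, so a
test always starts with credit at least k - 1. -/
theorem testAndRepair_spec {M : Matroid E} (hE : M.E = Set.univ) {k L : ℕ} (hk : 1 ≤ k)
    {P : Finset E} {n : ℕ} (d : ℕ) {I : Finset E} {l : List E} (hI : M.Indep (I : Set E))
    (hn : l.length ≤ n) (hL : Nat.clog 2 (l.filter (· ∈ P)).length ≤ L) :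
    RunSpec M k L P I l (k - 1 - d) (slack P d l) (testAndRepair k P n d I l) := by
  induction n generalizing d I l with
  | zero =>
    obtain rfl : l = [] := by simpa using hn
    exact ⟨rfl, by intro x _ h; simpa [testAndRepair] using h, by simp [testAndRepair]⟩
  | succ n ih =>
    match l with
    -- The list may end before a debt is repaid; here the condition `0 ≤ x + l.length` of `RunSpec`
    -- is what gives the bound.
    | [] => exact ⟨rfl, by intro x _ h; simpa [testAndRepair] using h, by simp [testAndRepair]⟩
    | e :: l =>
    have hn' : l.length ≤ n := by simpa using hn
    rw [testAndRepair]
    split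
    · next hd =>
      have hL' : Nat.clog 2 (l.filter (· ∈ P)).length ≤ L :=
        le_trans (Nat.clog_mono_right _ ((List.sublist_cons_self e l).filter _).length_le) hL
      -- An accepted predicted element has charge 0, so the slack pays for its query.
      have hslack : slack P (d - 1) l + (if e ∈ P then 1 else 0) ≤ slack P d (e :: l) := by
        unfold slack
        by_cases heP : e ∈ P
        · have : d ≠ 0 := by simpa [heP] using hd
          simp only [heP, decide_true, List.filter_cons_of_pos, reduceCtorEq, if_false, if_true]
          split <;> omega
        · simp only [heP, decide_false, Bool.false_eq_true, not_false_eq_true,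
            List.filter_cons_of_neg, if_false]
          split <;> omega
      by_cases hins : M.Indep (insert e I : Finset E)
      · have hg : greedy (indepOracle M) I (e :: l) =
            greedy (indepOracle M) (insert e I) l := by
          rw [greedy, if_pos (indepOracle_eq_true.2 hins)]
        have heG : e ∈ greedy (indepOracle M) (insert e I) l :=
          subset_greedy _ _ _ (Finset.mem_insert_self _ _)
        obtain ⟨h1, h2, h3⟩ := ih (d - 1) hins hn' hL'
        rw [← indepOracle_eq_true] at hins
        refine ⟨by simp [OracleAlgorithm.result, hins, h1, hg], fun x hx hx' => ?_, ?_⟩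
        · have := h2 (x + 1) (by omega) (by push_cast [List.length_cons] at hx'; omega)
          simp only [OracleAlgorithm.calls_query, hins, if_true]
          push_cast [List.length_cons] at this ⊢
          nlinarith
        · simp only [OracleAlgorithm.calls_query, hins, if_true]
          rw [hg, List.map_cons, List.sum_cons]
          have : 1 ≤ charge k L P (greedy (indepOracle M) (insert e I) l) e +
              (if e ∈ P then 1 else 0) := by
            simp only [charge, heG, if_true]; split <;> omega
          omega
      · have heG := notMem_greedy hI l hins
        rw [← indepOracle_eq_false] at hins
        have hg : greedy (indepOracle M) I (e :: l) = greedy (indepOracle M) I l := by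
          rw [greedy, if_neg (by simp [hins])]
        obtain ⟨h1, h2, h3⟩ := ih (d - 1) hI hn' hL'
        refine ⟨by simp [OracleAlgorithm.result, hins, h1, hg], fun x hx hx' => ?_, ?_⟩
        · have := h2 (x + 1) (by omega) (by push_cast [List.length_cons] at hx'; omega)
          simp only [OracleAlgorithm.calls_query, hins, Bool.false_eq_true, if_false]
          push_cast [List.length_cons] at this ⊢
          nlinarith
        · simp only [OracleAlgorithm.calls_query, hins, Bool.false_eq_true, if_false]
          rw [hg, List.map_cons, List.sum_cons]
          have : 1 ≤ charge k L P (greedy (indepOracle M) I l) e := by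
            simp only [charge, heG, if_false]; split <;> omega
          omega
    · next hd =>
      push Not at hd
      obtain ⟨rfl, hne⟩ := hd
      have hs : slack P 0 (e :: l) = 1 := by simp only [slack, if_neg hne]
      rw [hs]
      set q := (e :: l).filter (· ∈ P) with hq
      have hql : q.length ≤ (e :: l).length := List.length_filter_le _ _
      have hq0 : 1 ≤ q.length := List.length_pos_iff.2 hne
      by_cases htest : M.Indep (I ∪ q.toFinset : Finset E)
      · have ht := indepOracle_eq_true.2 htest
        obtain ⟨h1, h2, h3⟩ := trust_spec hk (K := testAndRepair k P n (k - 1))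
          (fun I l hI hn hL => by
            obtain ⟨h1, h2, h3⟩ := ih (k - 1) hI hn hL
            refine ⟨h1, fun x hx => h2 x (by omega), h3.trans ?_⟩
            have : slack P (k - 1) l ≤ k := by unfold slack; split <;> omega
            omega) htest hn hL
        refine ⟨by simp [OracleAlgorithm.result, ht, h1], fun x hx hx' => ?_, ?_⟩
        · have := h2 (x - k) (by omega) (by push_cast [List.length_cons]; omega)
          simp only [OracleAlgorithm.calls_query, ht, if_true]
          push_cast at this ⊢
          nlinarith
        · simp only [OracleAlgorithm.calls_query, ht, if_true]
          omega
      · have ht := indepOracle_eq_false.2 htest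
        -- A single predicted element falls into the second case: `Nat.clog 2 1 = 0`, and it is
        -- identified without a query.
        by_cases hsmall : q.length < k * Nat.clog 2 q.length
        · simp only [hsmall, if_true]
          refine ⟨by simp [OracleAlgorithm.result, ht, result_finish], fun x hx hx' => ?_, ?_⟩
          · simp only [OracleAlgorithm.calls_query, ht, Bool.false_eq_true, if_false,
              calls_finish]
            push_cast [List.length_cons] at hx ⊢
            nlinarith
          · simp only [OracleAlgorithm.calls_query, ht, Bool.false_eq_true, if_false,
              calls_finish]
            refine le_trans (length_lt_sum_charge ?_
              (hsmall.trans_le (Nat.mul_le_mul_left k hL))) (Nat.le_add_right _ _)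
            by_contra! hcon
            refine htest ((greedy_indep hI (e :: l)).subset ?_)
            intro y hy
            simp only [Finset.coe_union, Set.mem_union, Finset.mem_coe, List.mem_toFinset,
              hq, List.mem_filter, decide_eq_true_eq] at hy
            rcases hy with hy | ⟨hy, hyP⟩
            · exact subset_greedy _ _ _ hy
            · exact hcon y hy hyP
        · simp only [hsmall, if_false]
          obtain ⟨a, b, hab, hindep, hdep⟩ := search_spec e hI htest
            (Nat.le_pow_clog one_lt_two q.length)
          set f := (search e (Nat.clog 2 q.length) I q).result (indepOracle M) with hf
          have hfa : f ∉ a := fun h => hdep (by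
            rwa [Finset.insert_eq_of_mem (by simp [h])])
          obtain ⟨a', b', hl, ha', hfa'⟩ := filter_eq_append_cons hab hfa
          have her : (e :: l).erase f = a' ++ b' := by
            rw [hl, List.erase_append_right _ hfa', List.erase_cons_head]
          have hfP : f ∈ P := by
            have : f ∈ q := by rw [hab]; simp
            simpa using (List.mem_filter.1 this).2
          obtain ⟨hg, hfG⟩ := greedy_append_cons_of_dep hE hI (a := a') (b := b') hindep
            (by
              rw [← ha']
              intro y
              simp only [Finset.mem_union, List.mem_toFinset, List.mem_filter]
              tauto)
            Finset.subset_union_left hfa' hdep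
          have hlen := congrArg List.length hl
          have hqlen : q.length = ((a' ++ b').filter (· ∈ P)).length + 1 := by
            rw [hq, hl]
            simp [List.filter_append, hfP]
            omega
          obtain ⟨h1, h2, h3⟩ := ih (k * Nat.clog 2 q.length - 1) (l := a' ++ b') hI
            (by simp at hlen ⊢; omega)
            ((Nat.clog_mono_right _ (by omega)).trans hL)
          refine ⟨?_, fun x hx hx' => ?_, ?_⟩
          · simp only [OracleAlgorithm.result, ht, Bool.false_eq_true, if_false,
              OracleAlgorithm.result_bind, ← hf, her, h1]
            rw [hl, hg]
          · simp only [OracleAlgorithm.calls_query, ht, Bool.false_eq_true, if_false,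
              OracleAlgorithm.calls_bind, ← hf, her, calls_search]
            have hlen' : (e :: l).length = (a' ++ b').length + 1 := by
              simp at hlen ⊢; omega
            -- The negation of `hsmall`: the list is long enough to repay the search.
            have hkq : k * Nat.clog 2 q.length ≤ (e :: l).length := by omega
            have := h2 (x + 1 - (k * Nat.clog 2 q.length : ℕ)) (by push_cast at hx; omega)
              (by push_cast at hx; omega)
            rw [hlen']
            push_cast at this ⊢
            nlinarith
          · simp only [OracleAlgorithm.calls_query, ht, Bool.false_eq_true, if_false,
              OracleAlgorithm.calls_bind, ← hf, her, calls_search]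
            rw [hl, hg]
            set G := greedy (indepOracle M) I (a' ++ b')
            have hcf : charge k L P G f = 1 + (k + 1) * L := by simp [charge, hfG, hfP]
            have hsum : ((a' ++ f :: b').map (charge k L P G)).sum =
                charge k L P G f + ((a' ++ b').map (charge k L P G)).sum := by
              simp; omega
            -- The search takes `clog` queries and the next phase has slack at most k * `clog`, in
            -- total (k + 1) * `clog`; the remaining 1 in the charge of f pays the failed test.
            have hpay : Nat.clog 2 q.length +
                slack P (k * Nat.clog 2 q.length - 1) (a' ++ b') ≤ (k + 1) * L := by
              refine le_trans ?_ (Nat.mul_le_mul_left (k + 1) hL)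
              unfold slack
              split
              · nlinarith
              · next h =>
                have := List.length_pos_iff.2 h
                have h1 : 1 ≤ Nat.clog 2 q.length := Nat.clog_pos one_lt_two (by omega)
                have : 1 ≤ k * Nat.clog 2 q.length := Nat.mul_pos hk h1
                rw [add_mul]
                omega
            omega

end Algorithm

theorem matroidRank_eq_card {E : Type u} {M : Matroid E} {B : Finset E} (hB : M.IsBase (B : Set E)) :
    matroidRank M = B.card := by
  rw [matroidRank, ← hB.encard_eq_eRank, Set.encard_coe_eq_coe_finsetCard, ENat.toNat_natCast]

/-! ### Comparison of the greedy basis with the error measures. -/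

section Errors

variable {E : Type u} [Fintype E] [DecidableEq E]

theorem le_additionError {M Md : Matroid E} {w : E → ℝ} {P G : Finset E}
    (hP : IsMaxWeightBase Md w P) (hG : IsMaxWeightBase M w G)
    (h : ∀ B, IsMaxWeightBase M w B → (G \ P).card ≤ (B \ P).card) :
    (G \ P).card ≤ additionError M Md w := by
  have hfin : (additionDistance M w '' {S : Finset E | IsMaxWeightBase Md w S}).Finite :=
    (Set.toFinite _).image _
  refine le_trans ?_ (le_csSup hfin.bddAbove ⟨P, hP, rfl⟩)
  refine le_csInf ⟨_, G \ P, Finset.sdiff_disjoint, ⟨G, hG, ?_⟩, rfl⟩ ?_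
  · intro x hx
    simp only [Set.mem_union, Finset.mem_coe, Finset.mem_sdiff] at hx ⊢
    tauto
  · rintro m ⟨A, -, ⟨B, hB, hBA⟩, rfl⟩
    refine (h B hB).trans (Finset.card_le_card fun x hx => ?_)
    rw [Finset.mem_sdiff] at hx
    exact (hBA hx.1).resolve_left hx.2

theorem le_removalError {M Md : Matroid E} {w : E → ℝ} {P G : Finset E}
    (hP : IsMaxWeightBase Md w P) (hG : IsMaxWeightBase M w G)
    (h : ∀ B, IsMaxWeightBase M w B → (P \ G).card ≤ (P \ B).card) :
    (P \ G).card ≤ removalError M Md w := by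
  have hfin : (removalDistance M w '' {S : Finset E | IsMaxWeightBase Md w S}).Finite :=
    (Set.toFinite _).image _
  refine le_trans ?_ (le_csSup hfin.bddAbove ⟨P, hP, rfl⟩)
  refine le_csInf ⟨_, P \ G, Finset.sdiff_subset, ⟨G, hG, ?_⟩, rfl⟩ ?_
  · intro x hx
    simp only [Set.mem_sdiff, Finset.mem_coe, Finset.mem_sdiff] at hx ⊢
    tauto
  · rintro m ⟨R, -, ⟨B, hB, hBR⟩, rfl⟩
    refine (h B hB).trans (Finset.card_le_card fun x hx => ?_)
    rw [Finset.mem_sdiff] at hx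
    by_contra hxR
    exact hx.2 (hBR ⟨hx.1, hxR⟩)

/-- Holds element by element: adding 1 on G raises every base charge to 1, and only the error
surcharges remain. -/
theorem sum_charge (k L : ℕ) (P G : Finset E) :
    ∑ e, charge k L P G e + G.card =
      Fintype.card E + (G \ P).card * (k + 1) + (P \ G).card * ((k + 1) * L) := by
  have h1 : (G \ P).card = ∑ e, if e ∈ G ∧ e ∉ P then 1 else 0 := by
    rw [← Finset.card_filter]; congr 1; ext; simp
  have h2 : (P \ G).card = ∑ e, if e ∈ P ∧ e ∉ G then 1 else 0 := by
    rw [← Finset.card_filter]; congr 1; ext; simp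
  have h3 : G.card = ∑ e, if e ∈ G then 1 else 0 := by
    rw [← Finset.card_filter]; congr 1; ext; simp
  have h4 : Fintype.card E = ∑ _e : E, 1 := by simp
  rw [h1, h2, h3, h4, Finset.sum_mul, Finset.sum_mul, ← Finset.sum_add_distrib,
    ← Finset.sum_add_distrib, ← Finset.sum_add_distrib]
  refine Finset.sum_congr rfl fun e _ => ?_
  unfold charge
  by_cases hG : e ∈ G <;> by_cases hP : e ∈ P <;> simp [hG, hP, add_comm]

end Errors

/-! ### Assembly: correctness, certificate and the two bounds. -/

open Classical in
/-- Order the elements by non-increasing weight, predicted elements first among equals, and run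
the greedy algorithm with tests, starting with `k - 1` greedy steps. -/
noncomputable def predictedGreedy (k : ℕ) : MaxWeightBasisAlgorithm.{u} := fun _ _ w P =>
  testAndRepair k P (exists_ordered_list w P).choose.length (k - 1) ∅
    (exists_ordered_list w P).choose

open Classical in
theorem predictedGreedy_spec {k : ℕ} (hk : 1 ≤ k) {E : Type u} [Fintype E] (w : E → ℝ)
    (P : Finset E) {M : Matroid E} (hE : M.E = Set.univ) :
    M.IsBase (((predictedGreedy k E w P).result (indepOracle M) : Finset E) : Set E) ∧
      (∀ B : Finset E, M.IsBase (B : Set E) →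
        SetLexLE w P B ((predictedGreedy k E w P).result (indepOracle M))) ∧
      k * (predictedGreedy k E w P).calls (indepOracle M) ≤ (k + 1) * Fintype.card E ∧
      (predictedGreedy k E w P).calls (indepOracle M) ≤
        ∑ e, charge k (Nat.clog 2 P.card) P
          ((predictedGreedy k E w P).result (indepOracle M)) e + k := by
  obtain ⟨hnd, hmem, hpw⟩ := (exists_ordered_list w P).choose_spec
  unfold predictedGreedy
  set l := (exists_ordered_list w P).choose
  have huniv : l.toFinset = Finset.univ := by ext; simp [hmem]
  have hlen : l.length = Fintype.card E := by
    rw [← List.toFinset_card_of_nodup hnd, huniv, Finset.card_univ]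
  have hq : (l.filter (· ∈ P)).length ≤ P.card := by
    rw [← List.toFinset_card_of_nodup (hnd.filter _)]
    exact Finset.card_le_card fun x hx => by simpa [hmem] using hx
  obtain ⟨h1, h2, h3⟩ := testAndRepair_spec hE hk (k - 1) (I := ∅) (l := l)
    (by simp) le_rfl (Nat.clog_mono_right 2 hq)
  have hbase : ∀ B : Finset E, M.IsBase (B : Set E) → _ := fun B hB =>
    greedy_isBase_and_setLexLE hpw (I := ∅) (by simp) hB (by simp) (by simp [huniv])
  rw [h1]
  obtain ⟨B, hB⟩ := M.exists_isBase
  refine ⟨(hbase B.toFinset (by simpa using hB)).1, fun B hB => (hbase B hB).2, ?_, ?_⟩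
  -- With d = k - 1 the required initial credit is exactly 0.
  · have := h2 0 (by omega) (by omega)
    rw [add_zero] at this
    rw [← hlen]
    exact_mod_cast this
  · refine h3.trans ?_
    rw [← List.sum_toFinset _ hnd, huniv]
    refine Nat.add_le_add_left ?_ _
    unfold slack
    split <;> omega

theorem predictedGreedy_isMaxWeightBase {k : ℕ} (hk : 1 ≤ k) {E : Type u} [Fintype E]
    (w : E → ℝ) (P : Finset E) {M : Matroid E} (hE : M.E = Set.univ) :
    IsMaxWeightBase M w ((predictedGreedy k E w P).result (indepOracle M)) := by
  classical
  obtain ⟨h1, h2, -⟩ := predictedGreedy_spec hk w P hE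
  refine ⟨h1, fun B hB => ?_⟩
  rcases h2 B hB with h | h
  · exact h.le
  · exact h.1.le

theorem theorem3p7 (k : ℕ) (hk : 1 ≤ k) :
    ∃ alg : MaxWeightBasisAlgorithm.{u},
      ∀ (E : Type u) [Fintype E] (w : E → ℝ) (Md M : Matroid E),
        Md.E = Set.univ → M.E = Set.univ →
        ∀ Bd : Finset E, IsMaxWeightBase Md w Bd →
          -- correctness, and the queries made are a certificate
          IsMaxWeightBase M w ((alg E w Bd).result (indepOracle M)) ∧
          CertifiesMaxWeightBase (alg E w Bd) M w ∧
          -- number of clean-oracle calls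
          ((alg E w Bd).calls (indepOracle M) : ℝ) ≤
            min ((Fintype.card E : ℝ) - (matroidRank M : ℝ) + (k : ℝ)
                  + (additionError M Md w : ℝ) * ((k : ℝ) + 1)
                  + (removalError M Md w : ℝ) * ((k : ℝ) + 1)
                      * (⌈Real.logb 2 (matroidRank Md : ℝ)⌉ : ℝ))
                ((1 + 1 / (k : ℝ)) * (Fintype.card E : ℝ)) ∧
          -- consistency
          (M = Md → ((alg E w Bd).calls (indepOracle M) : ℝ) ≤
            (Fintype.card E : ℝ) - (matroidRank M : ℝ) + (k : ℝ)) ∧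
          -- robustness
          ((alg E w Bd).calls (indepOracle M) : ℝ) ≤
            (1 + 1 / (k : ℝ)) * (Fintype.card E : ℝ) := by
  classical
  refine ⟨predictedGreedy k, fun E _ w Md M hMd hM P hP => ?_⟩
  have hmax := predictedGreedy_isMaxWeightBase hk w P hM
  obtain ⟨hbase, hlex, hrob, hcharge⟩ := predictedGreedy_spec hk w P hM
  have hcert : CertifiesMaxWeightBase (predictedGreedy k E w P) M w := fun M' hM' hagree => by
    rw [← OracleAlgorithm.result_eq_of_agree _ _ _ hagree]
    exact predictedGreedy_isMaxWeightBase hk w P hM'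
  set G := (predictedGreedy k E w P).result (indepOracle M)
  set C := (predictedGreedy k E w P).calls (indepOracle M)
  have hinter : ∀ B, IsMaxWeightBase M w B → (B ∩ P).card ≤ (G ∩ P).card := fun B hB => by
    rcases hlex B hB.1 with h | h
    · exact absurd (hB.2 G hbase) (not_le.2 h)
    · exact h.2
  have hadd : ∀ B, IsMaxWeightBase M w B → (G \ P).card ≤ (B \ P).card := fun B hB => by
    have h1 := hinter B hB
    have h2 := Finset.card_inter_add_card_sdiff B P
    have h3 := Finset.card_inter_add_card_sdiff G P
    have h4 := (matroidRank_eq_card hB.1).symm.trans (matroidRank_eq_card hbase)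
    omega
  have hrem : ∀ B, IsMaxWeightBase M w B → (P \ G).card ≤ (P \ B).card := fun B hB => by
    have h1 := hinter B hB
    have h2 := Finset.card_inter_add_card_sdiff P B
    have h3 := Finset.card_inter_add_card_sdiff P G
    rw [Finset.inter_comm] at h2 h3
    omega
  have hrobust : (C : ℝ) ≤ (1 + 1 / (k : ℝ)) * (Fintype.card E : ℝ) := by
    have hk0 : (0 : ℝ) < k := by exact_mod_cast hk
    have : (k : ℝ) * C ≤ (k + 1) * Fintype.card E := by exact_mod_cast hrob
    rw [one_add_div hk0.ne', div_mul_eq_mul_div, le_div_iff₀ hk0]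
    linarith
  -- Rank 0 is included, since both sides are then 0 by convention.
  have hlog : (⌈Real.logb 2 (matroidRank Md : ℝ)⌉ : ℝ) = (Nat.clog 2 P.card : ℕ) := by
    have := Real.ceil_logb_natCast (b := 2) (Nat.cast_nonneg (α := ℝ) (matroidRank Md))
    rw [Nat.cast_ofNat] at this
    rw [this, Int.clog_natCast, matroidRank_eq_card hP.1, Int.cast_natCast]
  have hcount : (C : ℝ) ≤ (Fintype.card E : ℝ) - (matroidRank M : ℝ) + (k : ℝ)
      + ((G \ P).card : ℝ) * ((k : ℝ) + 1)
      + ((P \ G).card : ℝ) * ((k : ℝ) + 1) * (Nat.clog 2 P.card : ℕ) := by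
    have h1 := sum_charge k (Nat.clog 2 P.card) P G
    have h2 : C + G.card ≤ Fintype.card E + (G \ P).card * (k + 1) +
        (P \ G).card * ((k + 1) * Nat.clog 2 P.card) + k := by omega
    have h3 : (C : ℝ) + G.card ≤ Fintype.card E + (G \ P).card * (k + 1) +
        (P \ G).card * ((k + 1) * (Nat.clog 2 P.card : ℕ)) + k := by exact_mod_cast h2
    rw [matroidRank_eq_card hbase]
    linarith
  refine ⟨hmax, hcert, le_min (hcount.trans ?_) hrobust, ?_, hrobust⟩
  · rw [hlog]
    have h1 : ((G \ P).card : ℝ) ≤ additionError M Md w := by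
      exact_mod_cast le_additionError hP hmax hadd
    have h2 : ((P \ G).card : ℝ) ≤ removalError M Md w := by
      exact_mod_cast le_removalError hP hmax hrem
    gcongr
  · rintro rfl
    -- When the matroids coincide, P itself is a competitor at distance 0.
    have h1 : (G \ P).card = 0 := by simpa using hadd P hP
    have h2 : (P \ G).card = 0 := by simpa using hrem P hP
    simpa [h1, h2] using hcount
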